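/- **Setting.** All logarithms are to base $2$. A deletable error pattern of length $n$ is a pair $g=(e,s)\in\{0,1\}^n\times\{D,E,F\}^n$. For a word $x\in\{0,1\}^n$, let $F_g(x)$ be the word obtained from $x$ as follows: for each $i$ with $e_i=1$ the bit $x_i$ is deleted if $s_i=D$, replaced by the erasure symbol $\varepsilon$ if $s_i=E$, and flipped if $s_i=F$; bits with $e_i=0$ are unchanged. Let $F_g(x,m)$ be the result of corrupting in this way only the first $m$ bits of $x$ by the first $m$ entries of $g$. Let $\mathcal E_n(t)$ be the set of patterns with $\sum_i e_i\le t$. A code is a non-empty set $\mathcal C\subseteq\{0,1\}^n$, with redundancy $R(\mathcal C)=n-\log\#\mathcal C$. The code $\mathcal C$ corrects a set $\mathcal F$ of patterns in real time with delay at most $d$ if * $F_{g_1}(x_1)\ne F_{g_2}(x_2)$ for all $x_1\neq x_2$ in $\mathcal C$ and all $g_1,g_2\in\mathcal F$; and * for every $1\le z\le n-d$, all $x_1,x_2\in\mathcal C$ that differ in at least one of their first $z$ bits, and all $g_1,g_2\in\mathcal F$, one has $F_{g_1}(x_1,z+d)\neq F_{g_2}(x_2,z+d)$ (that is, the corruption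 of the first $z+d$ bits determines the first $z$ bits of the codeword). Let $\mathcal F(t,d)\subseteq\mathcal E_n(t)$ be a subset of maximum size that $\mathcal C$ corrects in real time with delay at most $d$. The $(t,d)$-real-time error probability of $\mathcal C$ is $$\rho(t,d)=\frac{\#(\mathcal E_n(t)\setminus\mathcal F(t,d))}{\#\mathcal E_n(t)}.$$ **Theorem.** Let $n,t,d$ be integers with $1\le t\le n^{1/3}/6$ and $4t\le d\le \frac{2n}{3t^2}$. Then there is a code $\mathcal C\subseteq\{0,1\}^n$ whose redundancy satisfies $$R(\mathcal C)\le n\cdot\frac{4\log(2d)}{d}$$ and whose real-time error probability, with delay $d$, satisfies $$\rho(t,d)\le 11\,\frac{t^2d}{n}.$$ For the same code, the second bound also holds if patterns that differ only in labels $s_i$ at positions with $e_i=0$ are counted as one pattern, so that $\#\mathcal E_n(t)=\sum_{k=0}^{t}\binom nk3^k$. -/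

import Mathlib

namespace DeletableErrors

/-- The three kinds of deletable errors: deletion `D`, erasure `E`, substitution `F`. -/
inductive ErrorKind : Type
  | D
  | E
  | F
  deriving DecidableEq

instance : Fintype ErrorKind where
  elems := {ErrorKind.D, ErrorKind.E, ErrorKind.F}
  complete := by intro k; cases k <;> simp

/-- Binary words of length `n`. -/
abbrev Word (n : ℕ) : Type := Fin n → Bool

/-- Deletable error patterns `g = (e, s)` of length `n`: `e i` says whether position `i` is hit by
an error, `s i` says which kind of error it then is. -/
abbrev ErrorPattern (n : ℕ) : Type := (Fin n → Bool) × (Fin n → ErrorKind)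

/-- What is received for one transmitted bit `b`. Received symbols are `some b` for a bit `b` and
`none` for the erasure symbol; a deleted bit leaves no trace. -/
def corruptBit (e : Bool) (s : ErrorKind) (b : Bool) : List (Option Bool) :=
  match e, s with
  | false, _ => [some b]
  | true, ErrorKind.D => []
  | true, ErrorKind.E => [none]
  | true, ErrorKind.F => [some (!b)]

/-- `F_g(x, m)`: the result of corrupting the first `m` bits of `x` by the first `m` entries
of `g`. -/
def corruptPrefix {n : ℕ} (g : ErrorPattern n) (x : Word n) (m : ℕ) : List (Option Bool) :=
  ((List.finRange n).take m).flatMap fun i => corruptBit (g.1 i) (g.2 i) (x i)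

/-- `F_g(x)`: the result of corrupting the whole word `x` by `g`. -/
def corrupt {n : ℕ} (g : ErrorPattern n) (x : Word n) : List (Option Bool) :=
  corruptPrefix g x n

/-- `E_n(r)`: the set of all error patterns of length `n` containing at most `r` errors. -/
def errorPatterns (n r : ℕ) : Finset (ErrorPattern n) :=
  Finset.univ.filter fun g => (Finset.univ.filter fun i => g.1 i = true).card ≤ r

/-- `E_n(r)` with the label `s i` of an error-free position `i` disregarded: every class of
patterns that differ only in such labels is represented once, by the pattern in which all these
labels are `D`. There are `∑ k ≤ r, (n choose k) * 3 ^ k` of them. -/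
def reducedErrorPatterns (n r : ℕ) : Finset (ErrorPattern n) :=
  (errorPatterns n r).filter fun g => ∀ i, g.1 i = false → g.2 i = ErrorKind.D

/-- The redundancy `n - log₂ #C` of a code `C`. -/
noncomputable def redundancy {n : ℕ} (C : Finset (Word n)) : ℝ :=
  (n : ℝ) - Real.logb 2 (C.card : ℝ)

/-- `C` is capable of correcting all error patterns in `S`. -/
def Corrects {n : ℕ} (C : Finset (Word n)) (S : Finset (ErrorPattern n)) : Prop :=
  ∀ x₁ ∈ C, ∀ x₂ ∈ C, x₁ ≠ x₂ → ∀ g₁ ∈ S, ∀ g₂ ∈ S, corrupt g₁ x₁ ≠ corrupt g₂ x₂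

/-- `C` corrects all error patterns in `S` in real time with delay at most `d`: it corrects them,
and for `1 ≤ z ≤ n - d` the corruption of the first `z + d` bits of a codeword determines the first
`z` bits of that codeword. -/
def CorrectsInRealTime {n : ℕ} (C : Finset (Word n)) (S : Finset (ErrorPattern n)) (d : ℕ) :
    Prop :=
  Corrects C S ∧
    ∀ z : ℕ, 1 ≤ z → z + d ≤ n → ∀ x₁ ∈ C, ∀ x₂ ∈ C,
      (∃ i : Fin n, i.val < z ∧ x₁ i ≠ x₂ i) →
        ∀ g₁ ∈ S, ∀ g₂ ∈ S, corruptPrefix g₁ x₁ (z + d) ≠ corruptPrefix g₂ x₂ (z + d)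

/-- `S` is a subset of `A` of maximum size among those that `C` corrects in real time with delay
at most `d`. -/
def IsLargestCorrectable {n : ℕ} (A : Finset (ErrorPattern n)) (C : Finset (Word n)) (d : ℕ)
    (S : Finset (ErrorPattern n)) : Prop :=
  S ⊆ A ∧ CorrectsInRealTime C S d ∧
    ∀ S' : Finset (ErrorPattern n), S' ⊆ A → CorrectsInRealTime C S' d → S'.card ≤ S.card

theorem exists_isLargestCorrectable {n : ℕ} (A : Finset (ErrorPattern n)) (C : Finset (Word n))
    (d : ℕ) : ∃ S, IsLargestCorrectable A C d S := by
  classical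
  obtain ⟨S, hS, hmax⟩ := Finset.exists_max_image
    (A.powerset.filter fun S => CorrectsInRealTime C S d) Finset.card
    ⟨∅, by simp [CorrectsInRealTime, Corrects]⟩
  simp only [Finset.mem_filter, Finset.mem_powerset] at hS hmax
  exact ⟨S, hS.1, hS.2, fun S' h h' => hmax S' ⟨h, h'⟩⟩

/-- The proportion of the error patterns in `A` that lie outside a subset of `A` of maximum size
that `C` corrects in real time with delay at most `d`. -/
noncomputable def errorProbability {n : ℕ} (A : Finset (ErrorPattern n)) (C : Finset (Word n))
    (d : ℕ) : ℝ :=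
  ((A \ (exists_isLargestCorrectable A C d).choose).card : ℝ) / (A.card : ℝ)

/-- The value does not depend on the choice of the subset of maximum size. -/
theorem errorProbability_eq {n : ℕ} {A : Finset (ErrorPattern n)} {C : Finset (Word n)} {d : ℕ}
    {S : Finset (ErrorPattern n)} (hS : IsLargestCorrectable A C d S) :
    errorProbability A C d = ((A \ S).card : ℝ) / (A.card : ℝ) := by
  have h := (exists_isLargestCorrectable A C d).choose_spec
  have hc := le_antisymm (hS.2.2 _ h.1 h.2.1) (h.2.2 _ hS.1 hS.2.1)
  rw [errorProbability, Finset.card_sdiff_of_subset h.1, Finset.card_sdiff_of_subset hS.1, hc]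

/-- The `(t, d)`-real-time error probability `ρ(t, d)` of the code `C`. -/
noncomputable def realTimeErrorProbability {n : ℕ} (C : Finset (Word n)) (t d : ℕ) : ℝ :=
  errorProbability (errorPatterns n t) C d

/-- The same quantity, with patterns that differ only in the labels of error-free positions
counted once. -/
noncomputable def reducedRealTimeErrorProbability {n : ℕ} (C : Finset (Word n)) (t d : ℕ) : ℝ :=
  errorProbability (reducedErrorPatterns n t) C d

end DeletableErrors

/-! Cut the word into blocks of length `b = d`. Every complete block ends with the marker `01` and
has a prescribed Varshamov–Tenengolts sum modulo `2 * b`. By pigeonhole (`exists_markedCode`) this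
costs a factor of at most `8 * b` per block, hence the redundancy.

Such a code handles all patterns whose errors are far apart and avoid the very end (`Spread`). If
two codewords yield the same received prefix, their readings can fall out of step only by one
symbol, and only between a deletion in one word and a nearby deletion in the other: a longer offset
would put the `1` of one word's markers against the `0` of the other's (`exists_del₂`). A block read
in step differs in at most two places; a block touched by an offset differs by one deletion on each
side. In both cases equal sums force equal blocks (`eq_of_vtSum_of_two`, `eq_of_vtSum_of_shift`). A
block is known once it is completely transmitted, so the delay is at most `b`.

A union bound over close pairs of errors and errors near the end shows that few patterns are not
spread (`card_not_spread_le`). -/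

namespace DeletableErrors

/-! ### Varshamov–Tenengolts sums of a single block -/

/-- The Varshamov–Tenengolts sum `∑ (i + 1) * x (s + i)` of the block of length `b` at `s`. -/
def vtSum (x : ℕ → Bool) (s b : ℕ) : ℤ :=
  ∑ i ∈ Finset.range b, ((i : ℤ) + 1) * (x (s + i)).toInt

theorem vtSum_sub (x y : ℕ → Bool) (s b : ℕ) :
    vtSum x s b - vtSum y s b =
      ∑ i ∈ Finset.range b, ((i : ℤ) + 1) * ((x (s + i)).toInt - (y (s + i)).toInt) := by
  simp only [vtSum, ← Finset.sum_sub_distrib, mul_sub]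

/-- Words with the same Varshamov–Tenengolts sum modulo `2 * b` that differ in at most two places
are equal. -/
theorem eq_of_vtSum_of_two {x y : ℕ → Bool} {s b p q : ℕ} (hp : p < b) (hq : q < b)
    (h : ∀ i < b, i ≠ p → i ≠ q → x (s + i) = y (s + i))
    (hvt : (2 * (b : ℤ)) ∣ vtSum x s b - vtSum y s b) :
    ∀ i < b, x (s + i) = y (s + i) := by
  rw [vtSum_sub] at hvt
  by_cases hpq : p = q
  · subst hpq
    rw [Finset.sum_eq_single p] at hvt
    · have hpe : x (s + p) = y (s + p) := by
        have hz := Int.eq_zero_of_abs_lt_dvd hvt (by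
          rw [abs_lt]
          cases x (s + p) <;> cases y (s + p) <;> simp <;> omega)
        revert hz
        cases x (s + p) <;> cases y (s + p) <;> simp <;> omega
      intro i hi
      by_cases hip : i = p
      · rw [hip, hpe]
      · exact h i hi hip hip
    · intro i hi hip
      rw [h i (Finset.mem_range.1 hi) hip hip]; simp
    · intro hn; exact absurd (Finset.mem_range.2 hp) hn
  · have hsub : ({p, q} : Finset ℕ) ⊆ Finset.range b := by
      intro i hi
      simp only [Finset.mem_insert, Finset.mem_singleton] at hi
      rcases hi with rfl | rfl <;> simpa
    rw [← Finset.sum_subset hsub, Finset.sum_pair hpq] at hvt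
    · have key : x (s + p) = y (s + p) ∧ x (s + q) = y (s + q) := by
        obtain ⟨c, hc⟩ := hvt
        -- As `p ≠ q`, the weights `p + 1` and `q + 1` are distinct and at most `b`, so even their
        -- sum stays below `2 * b`; this is what the modulus is for.
        have hc0 : ((p : ℤ) + 1) * ((x (s + p)).toInt - (y (s + p)).toInt) +
            ((q : ℤ) + 1) * ((x (s + q)).toInt - (y (s + q)).toInt) = 0 := by
          have hlt : |((p : ℤ) + 1) * ((x (s + p)).toInt - (y (s + p)).toInt) +
            ((q : ℤ) + 1) * ((x (s + q)).toInt - (y (s + q)).toInt)| < 2 * (b : ℤ) := by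
            rw [abs_lt]
            cases x (s + p) <;> cases y (s + p) <;> cases x (s + q) <;> cases y (s + q) <;>
              simp <;> omega
          exact Int.eq_zero_of_abs_lt_dvd ⟨c, hc⟩ hlt
        clear hc
        revert hc0
        cases x (s + p) <;> cases y (s + p) <;> cases x (s + q) <;> cases y (s + q) <;>
          simp <;> omega
      intro i hi
      by_cases hip : i = p
      · rw [hip, key.1]
      by_cases hiq : i = q
      · rw [hiq, key.2]
      exact h i hi hip hiq
    · intro i hi hni
      simp only [Finset.mem_insert, Finset.mem_singleton, not_or] at hni
      rw [h i (Finset.mem_range.1 hi) hni.1 hni.2]; simp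

/-- A symbol shared after the shift has weight `i + 2` on the left and `i + 1` on the right, so it
survives with coefficient one; only the two deleted symbols keep their full weights. -/
theorem sum_Ico_shift (u v : ℕ → ℤ) (p m : ℕ) (h : ∀ i, p ≤ i → i < p + m → u (i + 1) = v i) :
    ∑ i ∈ Finset.Ico p (p + m + 1), ((i : ℤ) + 1) * (u i - v i) =
      ((p : ℤ) + 1) * u p + ∑ i ∈ Finset.Ico p (p + m), v i - ((p + m : ℕ) + 1 : ℤ) * v (p + m) := by
  induction m with
  | zero => simp; ring
  | succ m ih =>
    rw [Finset.sum_Ico_succ_top (by omega), show p + (m + 1) = p + m + 1 by omega,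
      ih fun i h1 h2 => h i h1 (by omega), Finset.sum_Ico_succ_top (by omega) (fun i => v i),
      h (p + m) (by omega) (by omega)]
    push_cast
    ring

/-- Words with the same Varshamov–Tenengolts sum modulo `2 * b` that agree after the deletion of
position `p` from the first and of position `q ≥ p` from the second are equal. -/
theorem eq_of_vtSum_of_shift {x y : ℕ → Bool} {s b p q : ℕ} (hpq : p ≤ q) (hq : q < b)
    (hout : ∀ i < b, i < p ∨ q < i → x (s + i) = y (s + i))
    (hin : ∀ i, p ≤ i → i < q → x (s + i + 1) = y (s + i))
    (hvt : (2 * (b : ℤ)) ∣ vtSum x s b - vtSum y s b) :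
    ∀ i < b, x (s + i) = y (s + i) := by
  obtain ⟨m, rfl⟩ := Nat.exists_eq_add_of_le hpq
  rw [vtSum_sub] at hvt
  have hsub : Finset.Ico p (p + m + 1) ⊆ Finset.range b := by
    intro i hi
    simp only [Finset.mem_Ico, Finset.mem_range] at *
    omega
  rw [← Finset.sum_subset hsub (by
    intro i hi hni
    simp only [Finset.mem_Ico, Finset.mem_range] at *
    rw [hout i hi (by omega)]; simp),
    sum_Ico_shift (fun i => (x (s + i)).toInt) (fun i => (y (s + i)).toInt) p m
      (fun i h1 h2 => by simp only [← hin i h1 h2, Nat.add_assoc])] at hvt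
  have h01 : ∀ i, 0 ≤ (y (s + i)).toInt ∧ (y (s + i)).toInt ≤ 1 := by
    intro i; cases y (s + i) <;> simp
  have hN0 : 0 ≤ ∑ i ∈ Finset.Ico p (p + m), (y (s + i)).toInt :=
    Finset.sum_nonneg fun i _ => (h01 i).1
  have hNm : ∑ i ∈ Finset.Ico p (p + m), (y (s + i)).toInt ≤ m := by
    calc _ ≤ ∑ i ∈ Finset.Ico p (p + m), (1 : ℤ) := Finset.sum_le_sum fun i _ => (h01 i).2
      _ = m := by simp
  -- The difference has absolute value at most `p + m + 1 ≤ b`.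
  have hz := Int.eq_zero_of_abs_lt_dvd hvt (by
    rw [abs_lt]
    push_cast
    cases x (s + p) <;> cases y (s + (p + m)) <;> simp <;> constructor <;> omega)
  -- Zero is possible only if the symbols strung between the two deletions all coincide, that is, if
  -- both deletions hit the same run. If the end symbols differ, the sum would have to be negative
  -- or exceed `m`.
  have hconst : ∃ c : Bool, x (s + p) = c ∧ ∀ i, p ≤ i → i ≤ p + m → y (s + i) = c := by
    cases hx : x (s + p) <;> cases hy : y (s + (p + m)) <;> simp [hx, hy] at hz
    · refine ⟨false, rfl, fun i h1 h2 => ?_⟩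
      rcases Nat.lt_or_ge i (p + m) with h3 | h3
      · have := (Finset.sum_eq_zero_iff_of_nonneg fun i _ => (h01 i).1).1 hz i
          (Finset.mem_Ico.2 ⟨h1, h3⟩)
        revert this; cases y (s + i) <;> simp
      · rw [show i = p + m by omega, hy]
    · exfalso; omega
    · exfalso; omega
    · refine ⟨true, rfl, fun i h1 h2 => ?_⟩
      rcases Nat.lt_or_ge i (p + m) with h3 | h3
      · have hs : ∑ i ∈ Finset.Ico p (p + m), (1 - (y (s + i)).toInt) = 0 := by
          rw [Finset.sum_sub_distrib]; simp; omega
        have := (Finset.sum_eq_zero_iff_of_nonneg fun i _ => by have := h01 i; omega).1 hs i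
          (Finset.mem_Ico.2 ⟨h1, h3⟩)
        revert this; cases y (s + i) <;> simp
      · rw [show i = p + m by omega, hy]
  obtain ⟨c, hx, hy⟩ := hconst
  intro i hi
  by_cases hc : i < p ∨ p + m < i
  · exact hout i hi hc
  · rw [hy i (by omega) (by omega)]
    rcases Nat.eq_or_lt_of_le (show p ≤ i by omega) with h1 | h1
    · rw [← h1, hx]
    · obtain ⟨j, rfl⟩ : ∃ j, i = j + 1 := ⟨i - 1, by omega⟩
      rw [show s + (j + 1) = s + j + 1 by omega, hin j (by omega) (by omega),
        hy j (by omega) (by omega)]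

/-! ### Alignment of two readings of the same sequence -/

/-- Two words with error positions `err`, deleted positions `del` among them, and positions `pos`
of their symbols in the received sequence, which is the same for the prefixes of length `M` of
both. The errors in each word are at least `5 * b` apart, and every complete block of length `b`
ends with the marker `01`. -/
structure AlignedReadings (b M : ℕ) (x₁ x₂ : ℕ → Bool) (err₁ err₂ del₁ del₂ : ℕ → Prop)
    (pos₁ pos₂ : ℕ → ℕ) : Prop where
  two_le : 2 ≤ b
  err_of_del₁ : ∀ i, del₁ i → err₁ i
  err_of_del₂ : ∀ i, del₂ i → err₂ i
  pos_zero₁ : pos₁ 0 = 0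
  pos_zero₂ : pos₂ 0 = 0
  pos_del₁ : ∀ i < M, del₁ i → pos₁ (i + 1) = pos₁ i
  pos_del₂ : ∀ i < M, del₂ i → pos₂ (i + 1) = pos₂ i
  pos_keep₁ : ∀ i < M, ¬ del₁ i → pos₁ (i + 1) = pos₁ i + 1
  pos_keep₂ : ∀ i < M, ¬ del₂ i → pos₂ (i + 1) = pos₂ i + 1
  symbol_eq : ∀ i < M, ∀ j < M, ¬ err₁ i → ¬ err₂ j → pos₁ i = pos₂ j → x₁ i = x₂ j
  pos_end : pos₁ M = pos₂ M
  sep₁ : ∀ i j, err₁ i → err₁ j → i < j → i + 5 * b ≤ j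
  sep₂ : ∀ i j, err₂ i → err₂ j → i < j → i + 5 * b ≤ j
  marker₁ : ∀ k, (k + 1) * b ≤ M → x₁ (k * b + b - 2) = false ∧ x₁ (k * b + b - 1) = true
  marker₂ : ∀ k, (k + 1) * b ≤ M → x₂ (k * b + b - 2) = false ∧ x₂ (k * b + b - 1) = true

namespace AlignedReadings

variable {b M : ℕ} {x₁ x₂ : ℕ → Bool} {err₁ err₂ del₁ del₂ : ℕ → Prop} {pos₁ pos₂ : ℕ → ℕ}

theorem symm (h : AlignedReadings b M x₁ x₂ err₁ err₂ del₁ del₂ pos₁ pos₂) :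
    AlignedReadings b M x₂ x₁ err₂ err₁ del₂ del₁ pos₂ pos₁ where
  two_le := h.two_le
  err_of_del₁ := h.err_of_del₂
  err_of_del₂ := h.err_of_del₁
  pos_zero₁ := h.pos_zero₂
  pos_zero₂ := h.pos_zero₁
  pos_del₁ := h.pos_del₂
  pos_del₂ := h.pos_del₁
  pos_keep₁ := h.pos_keep₂
  pos_keep₂ := h.pos_keep₁
  symbol_eq i hi j hj h1 h2 h3 := (h.symbol_eq j hj i hi h2 h1 h3.symm).symm
  pos_end := h.pos_end.symm
  sep₁ := h.sep₂
  sep₂ := h.sep₁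
  marker₁ := h.marker₂
  marker₂ := h.marker₁

theorem pos_eq_add₁ (h : AlignedReadings b M x₁ x₂ err₁ err₂ del₁ del₂ pos₁ pos₂) {a c : ℕ}
    (hac : a ≤ c) (hc : c ≤ M) (hd : ∀ i, a ≤ i → i < c → ¬ del₁ i) :
    pos₁ c = pos₁ a + (c - a) := by
  induction c, hac using Nat.le_induction with
  | base => simp
  | succ c hac ih =>
    rw [h.pos_keep₁ c (by omega) (hd c hac (by omega)),
      ih (by omega) fun i h1 h2 => hd i h1 (by omega)]
    omega

theorem pos_eq_add₂ (h : AlignedReadings b M x₁ x₂ err₁ err₂ del₁ del₂ pos₁ pos₂) {a c : ℕ}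
    (hac : a ≤ c) (hc : c ≤ M) (hd : ∀ i, a ≤ i → i < c → ¬ del₂ i) :
    pos₂ c = pos₂ a + (c - a) :=
  h.symm.pos_eq_add₁ hac hc hd

/-- A deletion in the first word is soon followed by one in the second. -/
theorem exists_del₂ (h : AlignedReadings b M x₁ x₂ err₁ err₂ del₁ del₂ pos₁ pos₂) {p : ℕ}
    (hpM : p < M) (hp : pos₁ p = pos₂ p) (h1 : del₁ p) (h2 : ¬ del₂ p) :
    ∃ q, p < q ∧ q < M ∧ q < p + 2 * b + 3 ∧ del₂ q := by
  by_contra! hcon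
  have hb := h.two_le
  have no1 : ∀ i, p < i → i < p + 2 * b + 3 → ¬ err₁ i := fun i hi hi' he => by
    have := h.sep₁ p i (h.err_of_del₁ p h1) he hi
    omega
  have rel : ∀ m, p < m → m ≤ M → m ≤ p + 2 * b + 3 → pos₁ m + 1 = pos₂ m := by
    intro m hm hM hm'
    have e1 := h.pos_eq_add₁ (a := p + 1) (c := m) (by omega) hM fun i hi hi' hd =>
      no1 i (by omega) (by omega) (h.err_of_del₁ i hd)
    have e2 := h.pos_eq_add₂ (a := p + 1) (c := m) (by omega) hM fun i hi hi' =>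
      hcon i (by omega) (by omega) (by omega)
    rw [h.pos_del₁ p hpM h1] at e1
    rw [h.pos_keep₂ p hpM h2] at e2
    omega
  rcases Nat.lt_or_ge (p + 2 * b + 3) M with hM | hM
  -- The first word runs one symbol ahead, so the `1` of its marker is received in the place of the
  -- `0` of the second word's marker; only an error in the second word can explain this.
  · have err_marker : ∀ k, p + 3 ≤ (k + 1) * b → (k + 1) * b ≤ p + 2 + 2 * b →
        err₂ ((k + 1) * b - 2) := by
      intro k hk hk'
      by_contra he
      have hkb : (k + 1) * b = k * b + b := by ring
      have m1 := (h.marker₁ k (by omega)).2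
      have m2 := (h.marker₂ k (by omega)).1
      rw [← hkb] at m1 m2
      have hr := rel ((k + 1) * b - 1) (by omega) (by omega) (by omega)
      have hs := h.pos_keep₂ ((k + 1) * b - 2) (by omega) fun hd => he (h.err_of_del₂ _ hd)
      rw [show (k + 1) * b - 2 + 1 = (k + 1) * b - 1 by omega] at hs
      have := h.symbol_eq ((k + 1) * b - 1) (by omega) ((k + 1) * b - 2) (by omega)
        (no1 _ (by omega) (by omega)) he (by omega)
      rw [m1, m2] at this
      cases this
    -- The window of length `2 * b + 3` contains two consecutive markers. Both would need an error
    -- in the second word, yet these are only `b` apart.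
    have hdiv := Nat.div_add_mod (p + 2) b
    have hmod := Nat.mod_lt (p + 2) (show 0 < b by omega)
    set k := (p + 2) / b
    have hk1 : (k + 1) * b = b * k + b := by ring
    have hk2 : (k + 1 + 1) * b = b * k + b + b := by ring
    have e1 := err_marker k (by omega) (by omega)
    have e2 := err_marker (k + 1) (by omega) (by omega)
    have := h.sep₂ _ _ e1 e2 (by omega)
    omega
  -- If the prefix ends inside the window, the offset persists to `M`, against equal lengths.
  · have := rel M hpM le_rfl hM
    have := h.pos_end
    omega

/-- Position `p` lies between a deletion in the first word and the corresponding deletion in the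
second. -/
def Lag (b M : ℕ) (del₁ del₂ : ℕ → Prop) (pos₁ pos₂ : ℕ → ℕ) (p : ℕ) : Prop :=
  ∃ p₀ q, p₀ < p ∧ p ≤ q ∧ q < M ∧ q < p₀ + 2 * b + 3 ∧ del₁ p₀ ∧ del₂ q ∧
    pos₁ p₀ = pos₂ p₀ ∧ pos₁ p + 1 = pos₂ p

/-- Separation excludes a further deletion before `q`, so the offset remains exactly one until the
deletion at `q` cancels it. -/
theorem lag_succ (h : AlignedReadings b M x₁ x₂ err₁ err₂ del₁ del₂ pos₁ pos₂) {p : ℕ}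
    (hl : Lag b M del₁ del₂ pos₁ pos₂ p) :
    pos₁ (p + 1) = pos₂ (p + 1) ∨ Lag b M del₁ del₂ pos₁ pos₂ (p + 1) := by
  have hb := h.two_le
  obtain ⟨p₀, q, h1, h2, h3, h4, d1, d2, e1, e2⟩ := hl
  have n1 : ¬ del₁ p := fun hd => by
    have := h.sep₁ p₀ p (h.err_of_del₁ _ d1) (h.err_of_del₁ _ hd) h1
    omega
  have k1 := h.pos_keep₁ p (by omega) n1
  rcases Nat.eq_or_lt_of_le h2 with rfl | hlt
  · left
    rw [h.pos_del₂ p h3 d2]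
    omega
  · right
    have n2 : ¬ del₂ p := fun hd => by
      have := h.sep₂ p q (h.err_of_del₂ _ hd) (h.err_of_del₂ _ d2) hlt
      omega
    have k2 := h.pos_keep₂ p (by omega) n2
    exact ⟨p₀, q, by omega, by omega, h3, h4, d1, d2, e1, by omega⟩

theorem lag_of_del (h : AlignedReadings b M x₁ x₂ err₁ err₂ del₁ del₂ pos₁ pos₂) {p : ℕ}
    (hpM : p < M) (hp : pos₁ p = pos₂ p) (h1 : del₁ p) (h2 : ¬ del₂ p) :
    Lag b M del₁ del₂ pos₁ pos₂ (p + 1) := by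
  obtain ⟨q, q1, q2, q3, q4⟩ := h.exists_del₂ hpM hp h1 h2
  exact ⟨p, q, by omega, by omega, q2, q3, h1, q4, hp, by
    rw [h.pos_del₁ p hpM h1, h.pos_keep₂ p hpM h2, hp]⟩

/-- This invariant keeps the readings within one symbol of each other and attributes every offset to
one pair of deletions. -/
theorem eq_or_lag (h : AlignedReadings b M x₁ x₂ err₁ err₂ del₁ del₂ pos₁ pos₂) (p : ℕ)
    (hp : p ≤ M) :
    pos₁ p = pos₂ p ∨ Lag b M del₁ del₂ pos₁ pos₂ p ∨ Lag b M del₂ del₁ pos₂ pos₁ p := by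
  induction p with
  | zero => left; rw [h.pos_zero₁, h.pos_zero₂]
  | succ p ih =>
    rcases ih (by omega) with he | hl | hl
    · by_cases h1 : del₁ p <;> by_cases h2 : del₂ p
      · left; rw [h.pos_del₁ p hp h1, h.pos_del₂ p hp h2, he]
      · exact .inr (.inl (h.lag_of_del hp he h1 h2))
      · exact .inr (.inr (h.symm.lag_of_del hp he.symm h2 h1))
      · left; rw [h.pos_keep₁ p hp h1, h.pos_keep₂ p hp h2, he]
    · exact (h.lag_succ hl).imp_right .inl
    · exact (h.symm.lag_succ hl).imp Eq.symm .inr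

/-- The block and both deletions fit into a stretch shorter than `5 * b`, so these deletions are the
only errors that can affect the comparison, and the single-deletion property of the sum applies. -/
theorem block_eq_of_lag (h : AlignedReadings b M x₁ x₂ err₁ err₂ del₁ del₂ pos₁ pos₂) {s p : ℕ}
    (hs : s + b ≤ M) (hp : s ≤ p) (hp' : p ≤ s + b) (hl : Lag b M del₁ del₂ pos₁ pos₂ p)
    (hvt : (2 * (b : ℤ)) ∣ vtSum x₁ s b - vtSum x₂ s b) :
    ∀ i < b, x₁ (s + i) = x₂ (s + i) := by
  have hb := h.two_le
  obtain ⟨p₀, q, h1, h2, h3, h4, d1, d2, e1, -⟩ := hl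
  have n1 : ∀ i, s ≤ i → i < s + b ∨ i ≤ q → i ≠ p₀ → ¬ err₁ i := fun i hi hi' hne he => by
    rcases Nat.lt_or_gt_of_ne hne with hlt | hgt
    · have := h.sep₁ i p₀ he (h.err_of_del₁ _ d1) hlt
      omega
    · have := h.sep₁ p₀ i (h.err_of_del₁ _ d1) he hgt
      omega
  have n2 : ∀ i, s ≤ i ∨ p₀ ≤ i → i < s + b → i ≠ q → ¬ err₂ i := fun i hi hi' hne he => by
    rcases Nat.lt_or_gt_of_ne hne with hlt | hgt
    · have := h.sep₂ i q he (h.err_of_del₂ _ d2) hlt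
      omega
    · have := h.sep₂ q i (h.err_of_del₂ _ d2) he hgt
      omega
  have before : ∀ m, s ≤ m → m ≤ p₀ → pos₁ m = pos₂ m := by
    intro m hm hm'
    have f1 := h.pos_eq_add₁ hm' (by omega) fun i hi hi' hd =>
      n1 i (by omega) (by omega) (by omega) (h.err_of_del₁ _ hd)
    have f2 := h.pos_eq_add₂ hm' (by omega) fun i hi hi' hd =>
      n2 i (by omega) (by omega) (by omega) (h.err_of_del₂ _ hd)
    omega
  have s1 := h.pos_del₁ p₀ (by omega) d1
  have s2 := h.pos_keep₂ p₀ (by omega) fun hd => by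
    have := h.sep₂ p₀ q (h.err_of_del₂ _ hd) (h.err_of_del₂ _ d2) (by omega)
    omega
  have f1 : ∀ m, p₀ < m → m ≤ q + 1 ∨ m ≤ s + b → m ≤ M → pos₁ m = pos₁ p₀ + (m - (p₀ + 1)) := by
    intro m hm hm' hM
    have := h.pos_eq_add₁ (a := p₀ + 1) (c := m) hm hM fun i hi hi' hd => by
      have := h.sep₁ p₀ i (h.err_of_del₁ _ d1) (h.err_of_del₁ _ hd) (by omega)
      omega
    omega
  have f2 : ∀ m, p₀ < m → m ≤ q → pos₂ m = pos₂ p₀ + 1 + (m - (p₀ + 1)) := by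
    intro m hm hm'
    have := h.pos_eq_add₂ (a := p₀ + 1) (c := m) hm (by omega) fun i hi hi' hd => by
      have := h.sep₂ i q (h.err_of_del₂ _ hd) (h.err_of_del₂ _ d2) (by omega)
      omega
    omega
  have f3 : ∀ m, q < m → m ≤ s + b → pos₂ m = pos₂ q + (m - (q + 1)) := by
    intro m hm hm'
    have := h.pos_eq_add₂ (a := q + 1) (c := m) hm (by omega) fun i hi hi' hd => by
      have := h.sep₂ q i (h.err_of_del₂ _ d2) (h.err_of_del₂ _ hd) (by omega)
      omega
    have := h.pos_del₂ q h3 d2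
    omega
  -- A deletion before the block is moved to its first bit by truncated subtraction, one behind it
  -- to its last bit by `min`: the offset then reaches across that boundary.
  refine eq_of_vtSum_of_shift (p := p₀ - s) (q := min q (s + b - 1) - s) (by omega) (by omega)
    ?_ ?_ hvt
  · intro i hi hio
    rcases hio with hio | hio
    · exact h.symbol_eq _ (by omega) _ (by omega) (n1 _ (by omega) (by omega) (by omega))
        (n2 _ (by omega) (by omega) (by omega)) (before _ (by omega) (by omega))
    · have g1 := f1 (s + i) (by omega) (by omega) (by omega)
      have g2 := f2 q (by omega) (by omega)
      have g3 := f3 (s + i) (by omega) (by omega)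
      exact h.symbol_eq _ (by omega) _ (by omega) (n1 _ (by omega) (by omega) (by omega))
        (n2 _ (by omega) (by omega) (by omega)) (by omega)
  · intro i hi hi'
    have g1 := f1 (s + i + 1) (by omega) (by omega) (by omega)
    have g2 : pos₂ (s + i) = pos₁ (s + i + 1) := by
      rcases Nat.eq_or_lt_of_le (show p₀ ≤ s + i by omega) with hpi | hpi
      · rw [g1, ← hpi]; omega
      · rw [g1, f2 _ hpi (by omega)]; omega
    exact h.symbol_eq _ (by omega) _ (by omega) (n1 _ (by omega) (by omega) (by omega))
      (n2 _ (by omega) (by omega) (by omega)) g2.symm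

theorem exists_unique_err {err : ℕ → Prop} {s b : ℕ} (hb : 2 ≤ b)
    (sep : ∀ i j, err i → err j → i < j → i + 5 * b ≤ j) :
    ∃ p < b, ∀ i < b, err (s + i) → i = p := by
  by_cases he : ∃ p < b, err (s + p)
  · obtain ⟨p, hp, hpe⟩ := he
    refine ⟨p, hp, fun i hi hie => ?_⟩
    rcases Nat.lt_trichotomy i p with hlt | heq | hgt
    · have := sep _ _ hie hpe (by omega); omega
    · exact heq
    · have := sep _ _ hpe hie (by omega); omega
  · push Not at he
    -- The block is free of errors, so any position serves.
    exact ⟨0, by omega, fun i hi hie => absurd hie (he i hi)⟩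

/-- Blocks that are completely transmitted and have the same Varshamov–Tenengolts sums are
equal. -/
theorem block_eq (h : AlignedReadings b M x₁ x₂ err₁ err₂ del₁ del₂ pos₁ pos₂) {s : ℕ}
    (hs : s + b ≤ M) (hvt : (2 * (b : ℤ)) ∣ vtSum x₁ s b - vtSum x₂ s b) :
    ∀ i < b, x₁ (s + i) = x₂ (s + i) := by
  by_cases hall : ∀ p, s ≤ p → p ≤ s + b → pos₁ p = pos₂ p
  · obtain ⟨p, hp, hpu⟩ := exists_unique_err (s := s) h.two_le h.sep₁
    obtain ⟨q, hq, hqu⟩ := exists_unique_err (s := s) h.two_le h.sep₂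
    refine eq_of_vtSum_of_two hp hq (fun i hi hip hiq => ?_) hvt
    exact h.symbol_eq _ (by omega) _ (by omega) (fun he => hip (hpu i hi he))
      (fun he => hiq (hqu i hi he)) (hall _ (by omega) (by omega))
  · push Not at hall
    obtain ⟨p, hp1, hp2, hne⟩ := hall
    rcases h.eq_or_lag p (by omega) with he | hl | hl
    · exact absurd he hne
    · exact h.block_eq_of_lag hs hp1 hp2 hl hvt
    · intro i hi
      exact (h.symm.block_eq_of_lag hs hp1 hp2 hl (by rwa [dvd_sub_comm]) i hi).symm

/-- Behind the last error, the two words agree. -/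
theorem eq_of_no_err (h : AlignedReadings b M x₁ x₂ err₁ err₂ del₁ del₂ pos₁ pos₂) {i : ℕ}
    (hi : i < M) (h1 : ∀ j, i ≤ j → j < M → ¬ err₁ j) (h2 : ∀ j, i ≤ j → j < M → ¬ err₂ j) :
    x₁ i = x₂ i := by
  have e1 := h.pos_eq_add₁ hi.le le_rfl fun j hj hj' hd => h1 j hj hj' (h.err_of_del₁ _ hd)
  have e2 := h.pos_eq_add₂ hi.le le_rfl fun j hj hj' hd => h2 j hj hj' (h.err_of_del₂ _ hd)
  have := h.pos_end
  exact h.symbol_eq i hi i hi (h1 i le_rfl hi) (h2 i le_rfl hi) (by omega)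

end AlignedReadings

/-! ### From corrupted prefixes to readings -/

variable {n : ℕ}

theorem corruptPrefix_succ (g : ErrorPattern n) (x : Word n) {i : ℕ} (hi : i < n) :
    corruptPrefix g x (i + 1) =
      corruptPrefix g x i ++ corruptBit (g.1 ⟨i, hi⟩) (g.2 ⟨i, hi⟩) (x ⟨i, hi⟩) := by
  simp [corruptPrefix, List.take_add_one, hi]

theorem corruptPrefix_prefix (g : ErrorPattern n) (x : Word n) {i m : ℕ} (h : i ≤ m) :
    corruptPrefix g x i <+: corruptPrefix g x m := by
  have hp : (List.finRange n).take i <+: (List.finRange n).take m :=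
    List.take_prefix_take_left h
  obtain ⟨l, hl⟩ := hp
  exact ⟨l.flatMap fun i => corruptBit (g.1 i) (g.2 i) (x i), by
    rw [corruptPrefix, corruptPrefix, ← hl, List.flatMap_append]⟩

/-- The extension of a word by zeros. -/
def extend (x : Word n) (i : ℕ) : Bool :=
  if h : i < n then x ⟨i, h⟩ else false

@[simp]
theorem extend_val (x : Word n) (i : Fin n) : extend x i = x i := by
  simp [extend]

/-- Position `i` is hit by an error. -/
def IsError (g : ErrorPattern n) (i : ℕ) : Prop :=
  ∃ h : i < n, g.1 ⟨i, h⟩ = true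

/-- Position `i` is deleted. -/
def IsDeletion (g : ErrorPattern n) (i : ℕ) : Prop :=
  ∃ h : i < n, g.1 ⟨i, h⟩ = true ∧ g.2 ⟨i, h⟩ = ErrorKind.D

/-- The number of symbols received for the first `m` bits. -/
def outputPos (g : ErrorPattern n) (m : ℕ) : ℕ :=
  (corruptPrefix g (fun _ => false) m).length

/-- Whether a bit leaves a symbol depends on the pattern alone, so the zero word in `outputPos` is
immaterial. -/
theorem length_corruptPrefix (g : ErrorPattern n) (x : Word n) (m : ℕ) :
    (corruptPrefix g x m).length = outputPos g m := by
  have hbit : ∀ (e : Bool) (s : ErrorKind) (a b : Bool),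
      (corruptBit e s a).length = (corruptBit e s b).length := by
    intro e s a b
    cases e <;> cases s <;> rfl
  rw [outputPos, corruptPrefix, corruptPrefix, List.length_flatMap, List.length_flatMap]
  congr 2
  funext i
  exact hbit _ _ _ _

theorem outputPos_zero (g : ErrorPattern n) : outputPos g 0 = 0 := by
  simp [outputPos, corruptPrefix]

theorem outputPos_del (g : ErrorPattern n) {i : ℕ} (h : IsDeletion g i) :
    outputPos g (i + 1) = outputPos g i := by
  obtain ⟨hi, h1, h2⟩ := h
  simp [outputPos, corruptPrefix_succ g _ hi, h1, h2, corruptBit]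

theorem outputPos_keep (g : ErrorPattern n) {i : ℕ} (hi : i < n) (h : ¬ IsDeletion g i) :
    outputPos g (i + 1) = outputPos g i + 1 := by
  rw [outputPos, corruptPrefix_succ g _ hi, List.length_append, outputPos]
  simp only [IsDeletion, hi, exists_true_left, not_and] at h
  cases h1 : g.1 ⟨i, hi⟩ <;> cases h2 : g.2 ⟨i, hi⟩ <;> simp_all [corruptBit]

theorem getElem?_corruptPrefix (g : ErrorPattern n) (x : Word n) {i m : ℕ} (him : i < m)
    (hm : m ≤ n) (h : ¬ IsError g i) :
    (corruptPrefix g x m)[outputPos g i]? = some (some (extend x i)) := by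
  have hi : i < n := by omega
  simp only [IsError, hi, exists_true_left, Bool.not_eq_true] at h
  have hs := corruptPrefix_succ g x hi
  obtain ⟨l, hl⟩ := corruptPrefix_prefix g x (show i + 1 ≤ m from him)
  rw [← hl, hs, ← length_corruptPrefix g x, h]
  simp [corruptBit, extend, hi]

/-! ### Spread patterns and real-time correction -/

/-- The errors of `g` are at least `5 * b` apart, and there are none in the last `b - 1`
positions. -/
def Spread (b : ℕ) (g : ErrorPattern n) : Prop :=
  (∀ i j : Fin n, g.1 i = true → g.1 j = true → i < j → (i : ℕ) + 5 * b ≤ j) ∧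
    ∀ i : Fin n, g.1 i = true → (i : ℕ) + b ≤ n

/-- Every complete block of length `b` ends with `01`. -/
def HasMarkers (b : ℕ) (x : Word n) : Prop :=
  ∀ k, (k + 1) * b ≤ n →
    extend x (k * b + b - 2) = false ∧ extend x (k * b + b - 1) = true

theorem Spread.separated {b : ℕ} {g : ErrorPattern n} (hg : Spread b g) (i j : ℕ)
    (hi : IsError g i) (hj : IsError g j) (hij : i < j) : i + 5 * b ≤ j := by
  obtain ⟨hi, hi'⟩ := hi
  obtain ⟨hj, hj'⟩ := hj
  exact hg.1 ⟨i, hi⟩ ⟨j, hj⟩ hi' hj' hij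

theorem alignedReadings {b m : ℕ} (hb : 2 ≤ b) (hm : m ≤ n) {x₁ x₂ : Word n}
    {g₁ g₂ : ErrorPattern n} (hx₁ : HasMarkers b x₁) (hx₂ : HasMarkers b x₂) (hg₁ : Spread b g₁)
    (hg₂ : Spread b g₂) (heq : corruptPrefix g₁ x₁ m = corruptPrefix g₂ x₂ m) :
    AlignedReadings b m (extend x₁) (extend x₂) (IsError g₁) (IsError g₂) (IsDeletion g₁)
      (IsDeletion g₂) (outputPos g₁) (outputPos g₂) where
  two_le := hb
  err_of_del₁ _ h := ⟨h.1, h.2.1⟩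
  err_of_del₂ _ h := ⟨h.1, h.2.1⟩
  pos_zero₁ := outputPos_zero _
  pos_zero₂ := outputPos_zero _
  pos_del₁ _ _ h := outputPos_del _ h
  pos_del₂ _ _ h := outputPos_del _ h
  pos_keep₁ _ hi h := outputPos_keep _ (by omega) h
  pos_keep₂ _ hi h := outputPos_keep _ (by omega) h
  symbol_eq i hi j hj h1 h2 h3 := by
    have e1 := getElem?_corruptPrefix g₁ x₁ hi hm h1
    have e2 := getElem?_corruptPrefix g₂ x₂ hj hm h2
    rw [heq, h3, e2] at e1
    simpa using e1.symm
  pos_end := by rw [← length_corruptPrefix g₁ x₁, heq, length_corruptPrefix]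
  sep₁ := hg₁.separated
  sep₂ := hg₂.separated
  marker₁ k hk := hx₁ k (by omega)
  marker₂ k hk := hx₂ k (by omega)

/-- A code whose words carry markers and have prescribed Varshamov–Tenengolts sums in all complete
blocks of length `b` corrects every set of spread patterns in real time with delay `b`. -/
theorem correctsInRealTime_of_spread {b : ℕ} (hb : 2 ≤ b) {C : Finset (Word n)}
    {S : Finset (ErrorPattern n)} (hmark : ∀ x ∈ C, HasMarkers b x)
    (hvt : ∀ x ∈ C, ∀ y ∈ C, ∀ k, (k + 1) * b ≤ n →
      (2 * (b : ℤ)) ∣ vtSum (extend x) (k * b) b - vtSum (extend y) (k * b) b)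
    (hS : ∀ g ∈ S, Spread b g) : CorrectsInRealTime C S b := by
  have block : ∀ m ≤ n, ∀ x₁ ∈ C, ∀ x₂ ∈ C, ∀ g₁ ∈ S, ∀ g₂ ∈ S,
      corruptPrefix g₁ x₁ m = corruptPrefix g₂ x₂ m → ∀ i : Fin n, (i / b + 1) * b ≤ m →
        x₁ i = x₂ i := by
    intro m hm x₁ hx₁ x₂ hx₂ g₁ hg₁ g₂ hg₂ heq i hi
    have h := alignedReadings hb hm (hmark _ hx₁) (hmark _ hx₂) (hS _ hg₁) (hS _ hg₂) heq
    have := h.block_eq (s := i / b * b) (by rw [← Nat.succ_mul]; exact hi)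
      (hvt _ hx₁ _ hx₂ (i / b) (by omega)) (i % b) (Nat.mod_lt _ (by omega))
    rwa [Nat.div_add_mod', extend_val, extend_val] at this
  constructor
  · intro x₁ hx₁ x₂ hx₂ hne g₁ hg₁ g₂ hg₂ heq
    refine hne (funext fun i => ?_)
    rcases Nat.lt_or_ge n ((i / b + 1) * b) with hlt | hge
    · have h := alignedReadings hb le_rfl (hmark _ hx₁) (hmark _ hx₂) (hS _ hg₁) (hS _ hg₂) heq
      have hdm := Nat.div_add_mod' i b
      have hkb : (i / b + 1) * b = i / b * b + b := by ring
      -- The incomplete last block has at most `b - 1` positions, where spread patterns have no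
      -- errors; it is read off from the end.
      have := h.eq_of_no_err i.2
        (fun j hj hjn he => by
          obtain ⟨h1, h2⟩ := he
          have := (hS _ hg₁).2 ⟨j, h1⟩ h2
          simp only at this
          omega)
        (fun j hj hjn he => by
          obtain ⟨h1, h2⟩ := he
          have := (hS _ hg₂).2 ⟨j, h1⟩ h2
          simp only at this
          omega)
      rwa [extend_val, extend_val] at this
    · exact block n le_rfl x₁ hx₁ x₂ hx₂ g₁ hg₁ g₂ hg₂ heq i hge
  · rintro z - hz x₁ hx₁ x₂ hx₂ ⟨i, hi, hne⟩ g₁ hg₁ g₂ hg₂ heq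
    -- The block containing `i < z` ends no later than `i + b`, hence within the prefix.
    refine hne (block (z + b) hz x₁ hx₁ x₂ hx₂ g₁ hg₁ g₂ hg₂ heq i ?_)
    have hdm := Nat.div_add_mod' i b
    have hkb : (i / b + 1) * b = i / b * b + b := by ring
    omega

/-! ### Construction of the code by pigeonhole -/

/-- The word with the last two bits of every complete block of length `b` replaced by `01`. -/
def setMarkers (b : ℕ) (x : Word n) : Word n := fun i =>
  if i / b < n / b ∧ i % b = b - 2 then false
  else if i / b < n / b ∧ i % b = b - 1 then true
  else x i

theorem block_pos {b k r : ℕ} (hk : (k + 1) * b ≤ n) (hr : r < b) :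
    k * b + r < n ∧ (k * b + r) / b = k ∧ (k * b + r) % b = r ∧ k < n / b := by
  have hkb : (k + 1) * b = k * b + b := by ring
  refine ⟨by omega, ?_, ?_, ?_⟩
  · rw [Nat.add_comm, Nat.add_mul_div_right _ _ (by omega), Nat.div_eq_of_lt hr, Nat.zero_add]
  · rw [Nat.add_comm, Nat.add_mul_mod_self_right, Nat.mod_eq_of_lt hr]
  · exact (Nat.le_div_iff_mul_le (by omega)).2 hk

theorem hasMarkers_setMarkers {b : ℕ} (hb : 2 ≤ b) (x : Word n) :
    HasMarkers b (setMarkers b x) := by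
  intro k hk
  obtain ⟨h1, h2, h3, h4⟩ := block_pos hk (show b - 2 < b by omega)
  obtain ⟨h5, h6, h7, -⟩ := block_pos hk (show b - 1 < b by omega)
  rw [Nat.add_sub_assoc hb, Nat.add_sub_assoc (show 1 ≤ b by omega)]
  simp only [extend, h1, h5, dif_pos, setMarkers, h2, h3, h4, h6, h7, and_self, if_true, true_and]
  simp
  omega

/-- The Varshamov–Tenengolts sums of the word with markers, and the overwritten bits. -/
def blockLabels (b : ℕ) (x : Word n) : Fin (n / b) → ZMod (2 * b) × Bool × Bool := fun k =>
  ((vtSum (extend (setMarkers b x)) (k * b) b : ℤ), extend x (k * b + (b - 2)),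
    extend x (k * b + (b - 1)))

/-- The overwritten bits are part of the label, so setting markers is injective on each fibre of
`blockLabels` and loses no codewords. -/
theorem eq_of_setMarkers_eq {b : ℕ} {x y : Word n} (h : setMarkers b x = setMarkers b y)
    (hl : blockLabels b x = blockLabels b y) : x = y := by
  funext i
  have hi := congrFun h i
  have hdm := Nat.div_add_mod' i b
  by_cases hk : i / b < n / b
  · have hk' := congrFun hl ⟨i / b, hk⟩
    simp only [blockLabels, Prod.mk.injEq] at hk'
    by_cases h2 : i % b = b - 2
    · have := hk'.2.1
      rwa [← h2, hdm, extend_val, extend_val] at this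
    by_cases h1 : i % b = b - 1
    · have := hk'.2.2
      rwa [← h1, hdm, extend_val, extend_val] at this
    simpa [setMarkers, h1, h2] using hi
  · simpa [setMarkers, hk] using hi

/-- There is a large code of words with markers and prescribed Varshamov–Tenengolts sums. -/
theorem exists_markedCode (n : ℕ) {b : ℕ} (hb : 2 ≤ b) :
    ∃ C : Finset (Word n), (2 : ℝ) ^ n / (8 * (b : ℝ)) ^ (n / b) ≤ C.card ∧
      (∀ x ∈ C, HasMarkers b x) ∧
      ∀ x ∈ C, ∀ y ∈ C, ∀ k, (k + 1) * b ≤ n →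
        (2 * (b : ℤ)) ∣ vtSum (extend x) (k * b) b - vtSum (extend y) (k * b) b := by
  classical
  have : NeZero (2 * b) := ⟨by omega⟩
  have hcard : Fintype.card (Fin (n / b) → ZMod (2 * b) × Bool × Bool) = (8 * b) ^ (n / b) := by
    simp [ZMod.card]
    congr 1
    ring
  have hb0 : (0 : ℝ) < 8 * (b : ℝ) := by
    have : (0 : ℝ) < b := by exact_mod_cast (show 0 < b by omega)
    positivity
  obtain ⟨l, hl⟩ := Fintype.exists_le_card_fiber_of_nsmul_le_card
    (blockLabels b : Word n → Fin (n / b) → ZMod (2 * b) × Bool × Bool)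
    (b := (2 : ℝ) ^ n / (8 * (b : ℝ)) ^ (n / b)) (by
      rw [hcard, nsmul_eq_mul]
      push_cast
      rw [mul_div_cancel₀ _ (by positivity)]
      simp)
  refine ⟨(Finset.univ.filter fun x => blockLabels b x = l).image (setMarkers b), ?_, ?_, ?_⟩
  · rw [Finset.card_image_of_injOn]
    · exact hl
    · intro x hx y hy hxy
      simp only [Finset.coe_filter, Finset.mem_univ, true_and, Set.mem_ofPred_eq] at hx hy
      exact eq_of_setMarkers_eq hxy (hx.trans hy.symm)
  · intro x hx
    obtain ⟨y, -, rfl⟩ := Finset.mem_image.1 hx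
    exact hasMarkers_setMarkers hb y
  · intro x hx y hy k hk
    obtain ⟨x, hx', rfl⟩ := Finset.mem_image.1 hx
    obtain ⟨y, hy', rfl⟩ := Finset.mem_image.1 hy
    have hk' := (block_pos hk (show 0 < b by omega)).2.2.2
    have he := congrFun ((Finset.mem_filter.1 hy').2.trans (Finset.mem_filter.1 hx').2.symm)
      ⟨k, hk'⟩
    simp only [blockLabels, Prod.mk.injEq] at he
    have := (ZMod.intCast_eq_intCast_iff_dvd_sub _ _ _).1 he.1
    exact_mod_cast this

/-! ### Counting patterns that are not spread -/

/-- The pattern with its positions permuted. -/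
def permute (σ : Equiv.Perm (Fin n)) (g : ErrorPattern n) : ErrorPattern n :=
  (g.1 ∘ σ, g.2 ∘ σ)

theorem permute_injective (σ : Equiv.Perm (Fin n)) : Function.Injective (permute σ) := by
  intro g h hgh
  simp only [permute, Prod.mk.injEq] at hgh
  exact Prod.ext (σ.surjective.injective_comp_right hgh.1)
    (σ.surjective.injective_comp_right hgh.2)

theorem weight_permute (σ : Equiv.Perm (Fin n)) (g : ErrorPattern n) :
    (Finset.univ.filter fun i => (permute σ g).1 i = true).card =
      (Finset.univ.filter fun i => g.1 i = true).card := by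
  refine Finset.card_bij (fun i _ => σ i) ?_ ?_ ?_
  · intro i hi; exact Finset.mem_filter.2 ⟨Finset.mem_univ _, (Finset.mem_filter.1 hi).2⟩
  · intro i _ j _ h; exact σ.injective h
  · intro j hj
    refine ⟨σ.symm j, Finset.mem_filter.2 ⟨Finset.mem_univ _, ?_⟩, by simp⟩
    simpa [permute] using (Finset.mem_filter.1 hj).2

theorem permute_mem_errorPatterns {t : ℕ} (σ : Equiv.Perm (Fin n)) {g : ErrorPattern n}
    (hg : g ∈ errorPatterns n t) : permute σ g ∈ errorPatterns n t := by
  rw [errorPatterns, Finset.mem_filter] at hg ⊢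
  exact ⟨Finset.mem_univ _, by rw [weight_permute]; exact hg.2⟩

theorem permute_mem_reducedErrorPatterns {t : ℕ} (σ : Equiv.Perm (Fin n)) {g : ErrorPattern n}
    (hg : g ∈ reducedErrorPatterns n t) : permute σ g ∈ reducedErrorPatterns n t := by
  rw [reducedErrorPatterns, Finset.mem_filter] at hg ⊢
  exact ⟨permute_mem_errorPatterns σ hg.1, fun i hi => hg.2 (σ i) hi⟩

/-- In a set of patterns that is closed under permutations, the patterns with an error at `i` make
up at most the fraction `t / n`. -/
theorem card_error_mul_le {t : ℕ} {A : Finset (ErrorPattern n)}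
    (hperm : ∀ σ, ∀ g ∈ A, permute σ g ∈ A)
    (hw : ∀ g ∈ A, (Finset.univ.filter fun i => g.1 i = true).card ≤ t) (i : Fin n) :
    n * (A.filter fun g => g.1 i = true).card ≤ t * A.card := by
  have hle : ∀ j, (A.filter fun g => g.1 i = true).card ≤
      (A.filter fun g => g.1 j = true).card := fun j => by
    refine Finset.card_le_card_of_injOn (permute (Equiv.swap i j)) ?_
      (permute_injective _).injOn
    intro g hg
    simp only [Finset.coe_filter, Set.mem_ofPred_eq] at hg ⊢
    exact ⟨hperm _ _ hg.1, by simp [permute, hg.2]⟩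
  calc n * (A.filter fun g => g.1 i = true).card
      = ∑ j : Fin n, (A.filter fun g => g.1 i = true).card := by simp
    _ ≤ ∑ j : Fin n, (A.filter fun g => g.1 j = true).card := Finset.sum_le_sum fun j _ => hle j
    _ = ∑ g ∈ A, (Finset.univ.filter fun j => g.1 j = true).card := by
        simp only [Finset.card_filter]
        exact Finset.sum_comm
    _ ≤ ∑ g ∈ A, t := Finset.sum_le_sum hw
    _ = t * A.card := by simp [mul_comm]

/-- Double transitivity makes all ordered pairs of distinct positions equally likely to carry
errors. -/
theorem exists_perm_pair {i j i' j' : Fin n} (h : i ≠ j) (h' : i' ≠ j') :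
    ∃ σ : Equiv.Perm (Fin n), σ i' = i ∧ σ j' = j := by
  refine ⟨Equiv.swap (Equiv.swap i' i j') j * Equiv.swap i' i, ?_, by simp⟩
  have : i ≠ Equiv.swap i' i j' := fun he => h' <| (Equiv.swap i' i).injective <| by simp [← he]
  simp [Equiv.swap_apply_of_ne_of_ne this h]

/-- The corresponding bound for errors at two positions. -/
theorem card_two_errors_mul_le {t : ℕ} {A : Finset (ErrorPattern n)}
    (hperm : ∀ σ, ∀ g ∈ A, permute σ g ∈ A)
    (hw : ∀ g ∈ A, (Finset.univ.filter fun i => g.1 i = true).card ≤ t) {i j : Fin n}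
    (hij : i ≠ j) :
    n * (n - 1) * (A.filter fun g => g.1 i = true ∧ g.1 j = true).card ≤
      t * (t - 1) * A.card := by
  have hle : ∀ p ∈ (Finset.univ : Finset (Fin n)).offDiag,
      (A.filter fun g => g.1 i = true ∧ g.1 j = true).card ≤
      (A.filter fun g => g.1 p.1 = true ∧ g.1 p.2 = true).card := fun p hp => by
    obtain ⟨σ, h1, h2⟩ := exists_perm_pair hij (Finset.mem_offDiag.1 hp).2.2
    refine Finset.card_le_card_of_injOn (permute σ) ?_ (permute_injective _).injOn
    intro g hg
    simp only [Finset.coe_filter, Set.mem_ofPred_eq] at hg ⊢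
    exact ⟨hperm _ _ hg.1, by simp [permute, hg.2, h1, h2]⟩
  calc n * (n - 1) * (A.filter fun g => g.1 i = true ∧ g.1 j = true).card
      = ∑ p ∈ (Finset.univ : Finset (Fin n)).offDiag,
          (A.filter fun g => g.1 i = true ∧ g.1 j = true).card := by
        simp [Finset.offDiag_card, Nat.mul_sub]
    _ ≤ ∑ p ∈ (Finset.univ : Finset (Fin n)).offDiag,
          (A.filter fun g => g.1 p.1 = true ∧ g.1 p.2 = true).card := Finset.sum_le_sum hle
    _ = ∑ g ∈ A, ((Finset.univ : Finset (Fin n)).offDiag.filter fun p =>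
          g.1 p.1 = true ∧ g.1 p.2 = true).card := by
        simp only [Finset.card_filter]
        exact Finset.sum_comm
    _ ≤ ∑ g ∈ A, t * (t - 1) := by
        refine Finset.sum_le_sum fun g hg => ?_
        have he : ((Finset.univ : Finset (Fin n)).offDiag.filter fun p =>
            g.1 p.1 = true ∧ g.1 p.2 = true) =
            (Finset.univ.filter fun i => g.1 i = true).offDiag := by
          ext p; simp; tauto
        rw [he, Finset.offDiag_card, ← Nat.mul_sub_one]
        exact Nat.mul_le_mul (hw g hg) (Nat.sub_le_sub_right (hw g hg) 1)
    _ = t * (t - 1) * A.card := by simp [mul_comm]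

theorem card_close_pairs_le (n w : ℕ) :
    ((Finset.univ : Finset (Fin n × Fin n)).filter
      fun p => p.1 < p.2 ∧ (p.2 : ℕ) < p.1 + w).card ≤ n * w := by
  calc _ ≤ ((Finset.univ : Finset (Fin n)) ×ˢ Finset.range w).card := by
        refine Finset.card_le_card_of_injOn (fun p => (p.1, (p.2 : ℕ) - p.1)) ?_ ?_
        · intro p hp
          simp only [Finset.coe_filter, Finset.mem_univ, true_and, Set.mem_ofPred_eq,
            Fin.lt_def] at hp
          simp only [Finset.coe_product, Set.mem_prod, Finset.mem_coe, Finset.mem_univ,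
            Finset.mem_range, true_and]
          omega
        · intro p hp q hq hpq
          simp only [Finset.coe_filter, Finset.mem_univ, true_and, Set.mem_ofPred_eq,
            Fin.lt_def, Prod.mk.injEq] at hp hq hpq
          refine Prod.ext hpq.1 (Fin.ext ?_)
          have := congrArg Fin.val hpq.1
          omega
    _ = n * w := by simp

theorem card_last_le (n b : ℕ) :
    ((Finset.univ : Finset (Fin n)).filter fun i : Fin n => n < (i : ℕ) + b).card ≤ b := by
  calc _ ≤ (Finset.Ico (n - b) n).card := by
        refine Finset.card_le_card_of_injOn Fin.val ?_ Fin.val_injective.injOn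
        intro i hi
        simp only [Finset.coe_filter, Finset.mem_univ, true_and, Set.mem_ofPred_eq] at hi
        simp only [Finset.coe_Ico, Set.mem_Ico]
        omega
    _ ≤ b := by simp; omega

open Classical in
/-- Few patterns are not spread. -/
theorem card_not_spread_le {t b : ℕ} (ht : 1 ≤ t) (htn : t ≤ n) (hn : 2 ≤ n)
    {A : Finset (ErrorPattern n)} (hperm : ∀ σ, ∀ g ∈ A, permute σ g ∈ A)
    (hw : ∀ g ∈ A, (Finset.univ.filter fun i => g.1 i = true).card ≤ t) :
    ((A.filter fun g => ¬ Spread b g).card : ℝ) ≤ 6 * ((t : ℝ) ^ 2 * b / n) * A.card := by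
  have hn0 : (0 : ℝ) < n := by exact_mod_cast (show 0 < n by omega)
  have hn1 : (0 : ℝ) < (n : ℝ) - 1 := by
    have : (2 : ℝ) ≤ n := by exact_mod_cast hn
    linarith
  have ht1 : (1 : ℝ) ≤ t := by exact_mod_cast ht
  have htn' : (t : ℝ) ≤ n := by exact_mod_cast htn
  have h1 : ∀ i : Fin n, ((A.filter fun g => g.1 i = true).card : ℝ) ≤ t * A.card / n := fun i => by
    rw [le_div_iff₀ hn0, mul_comm]
    exact_mod_cast card_error_mul_le hperm hw i
  have h2 : ∀ i j : Fin n, i ≠ j →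
      ((A.filter fun g => g.1 i = true ∧ g.1 j = true).card : ℝ) ≤
        (t : ℝ) ^ 2 * A.card / n ^ 2 := fun i j hij => by
    have h := card_two_errors_mul_le hperm hw hij
    have h' : (n : ℝ) * (n - 1) * (A.filter fun g => g.1 i = true ∧ g.1 j = true).card ≤
        t * (t - 1) * A.card := by
      rw [← Nat.cast_pred (R := ℝ) (n := n) (by omega), ← Nat.cast_pred (R := ℝ) (n := t) (by omega)]
      exact_mod_cast h
    rw [le_div_iff₀ (by positivity)]
    refine le_of_mul_le_mul_left ?_ hn1
    -- From `t ≤ n`: `(t - 1) / (n - 1) ≤ t / n`, which turns the exact pair bound into `t ^ 2 / n ^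
    -- 2`.
    have h3 : (n : ℝ) * (t - 1) ≤ (n - 1) * t := by linarith
    have h4 := mul_le_mul_of_nonneg_left h' hn0.le
    have h5 := mul_le_mul_of_nonneg_right h3 (show (0 : ℝ) ≤ t * A.card by positivity)
    nlinarith [h4, h5]
  set P := (Finset.univ : Finset (Fin n × Fin n)).filter
      fun p => p.1 < p.2 ∧ (p.2 : ℕ) < p.1 + 5 * b with hP
  set Q := (Finset.univ : Finset (Fin n)).filter fun i : Fin n => n < (i : ℕ) + b with hQ
  have hsub : (A.filter fun g => ¬ Spread b g) ⊆
      (P.biUnion fun p => A.filter fun g => g.1 p.1 = true ∧ g.1 p.2 = true) ∪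
        Q.biUnion fun i => A.filter fun g => g.1 i = true := by
    intro g hg
    rw [Finset.mem_filter, Spread, not_and_or] at hg
    obtain ⟨hgA, hg | hg⟩ := hg
    · push Not at hg
      obtain ⟨i, j, hi, hj, hij, hlt⟩ := hg
      refine Finset.mem_union_left _ (Finset.mem_biUnion.2 ⟨(i, j), ?_, ?_⟩)
      · simp [hP, hij, hlt]
      · simp [hgA, hi, hj]
    · push Not at hg
      obtain ⟨i, hi, hlt⟩ := hg
      refine Finset.mem_union_right _ (Finset.mem_biUnion.2 ⟨i, ?_, ?_⟩)
      · simp [hQ, hlt]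
      · simp [hgA, hi]
  have hPc : (P.card : ℝ) ≤ n * (5 * b) := by exact_mod_cast card_close_pairs_le n (5 * b)
  have hQc : (Q.card : ℝ) ≤ b := by exact_mod_cast card_last_le n b
  have hbound : ((A.filter fun g => ¬ Spread b g).card : ℝ) ≤
      P.card * ((t : ℝ) ^ 2 * A.card / n ^ 2) + Q.card * (t * A.card / n) := by
    calc ((A.filter fun g => ¬ Spread b g).card : ℝ)
        ≤ ((∑ p ∈ P, (A.filter fun g => g.1 p.1 = true ∧ g.1 p.2 = true).card +
          ∑ i ∈ Q, (A.filter fun g => g.1 i = true).card : ℕ) : ℝ) := by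
          exact_mod_cast (Finset.card_le_card hsub).trans ((Finset.card_union_le _ _).trans
            (Nat.add_le_add Finset.card_biUnion_le Finset.card_biUnion_le))
      _ ≤ _ := by
          push_cast
          rw [← nsmul_eq_mul, ← nsmul_eq_mul]
          refine add_le_add (Finset.sum_le_card_nsmul _ _ _ fun p hp => h2 _ _ ?_)
            (Finset.sum_le_card_nsmul _ _ _ fun i _ => h1 i)
          exact (Finset.mem_filter.1 hp).2.1.ne
  calc _ ≤ _ := hbound
    _ ≤ n * (5 * b) * ((t : ℝ) ^ 2 * A.card / n ^ 2) + b * (t ^ 2 * A.card / n) := by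
        -- Close pairs contribute five units of `t ^ 2 * b / n`, the end positions at most one more.
        have : (t : ℝ) ≤ t ^ 2 := by nlinarith
        gcongr
    _ = 6 * ((t : ℝ) ^ 2 * b / n) * A.card := by
        field_simp
        ring

/-! ### Error probability, redundancy and conclusion -/

theorem errorProbability_le {A S : Finset (ErrorPattern n)} {C : Finset (Word n)} {d : ℕ} {r : ℝ}
    (hSA : S ⊆ A) (hS : CorrectsInRealTime C S d) (hr : 0 ≤ r)
    (h : ((A \ S).card : ℝ) ≤ r * A.card) : errorProbability A C d ≤ r := by
  obtain ⟨T, hT⟩ := exists_isLargestCorrectable A C d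
  rw [errorProbability_eq hT]
  refine div_le_of_le_mul₀ (by positivity) hr (le_trans ?_ h)
  rw [Finset.card_sdiff_of_subset hT.1, Finset.card_sdiff_of_subset hSA]
  exact_mod_cast Nat.sub_le_sub_left (hT.2.2 S hSA hS) _

theorem redundancy_le {b : ℕ} (hb : 2 ≤ b) {C : Finset (Word n)}
    (hC : (2 : ℝ) ^ n / (8 * (b : ℝ)) ^ (n / b) ≤ C.card) :
    redundancy C ≤ (n : ℝ) * (4 * Real.logb 2 (2 * (b : ℝ)) / (b : ℝ)) := by
  have hb2 : (2 : ℝ) ≤ b := by exact_mod_cast hb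
  have hlog : (n : ℝ) - (n / b : ℕ) * Real.logb 2 (8 * b) ≤ Real.logb 2 C.card := by
    have h := Real.logb_le_logb_of_le (b := 2) (by norm_num) (by positivity) hC
    rw [Real.logb_div (by positivity) (by positivity), Real.logb_pow, Real.logb_pow,
      Real.logb_self_eq_one (by norm_num), mul_one] at h
    exact h
  have h8 : Real.logb 2 (8 * b) ≤ 4 * Real.logb 2 (2 * b) := by
    have : (4 : ℝ) * Real.logb 2 (2 * b) = Real.logb 2 ((2 * b) ^ 4) := by
      rw [Real.logb_pow]; norm_num
    rw [this]
    -- The factor four in the redundancy comes from `8 * b ≤ (2 * b) ^ 4`.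
    refine Real.logb_le_logb_of_le (by norm_num) (by positivity) ?_
    nlinarith [pow_le_pow_left₀ (by norm_num) hb2 3]
  have h0 : 0 ≤ Real.logb 2 (2 * (b : ℝ)) := Real.logb_nonneg (by norm_num) (by linarith)
  calc redundancy C ≤ (n / b : ℕ) * Real.logb 2 (8 * b) := by rw [redundancy]; linarith
    _ ≤ (n / b : ℕ) * (4 * Real.logb 2 (2 * b)) := by gcongr
    _ ≤ ((n : ℝ) / b) * (4 * Real.logb 2 (2 * b)) := by gcongr; exact Nat.cast_div_le
    _ = _ := by ring

end DeletableErrors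

theorem theorem2 (n t d : ℕ) (ht1 : 1 ≤ t) (ht2 : (t : ℝ) ≤ (n : ℝ) ^ ((1 : ℝ) / 3) / 6)
    (hd1 : 4 * t ≤ d) (hd2 : (d : ℝ) ≤ 2 * (n : ℝ) / (3 * (t : ℝ) ^ 2)) :
    ∃ C : Finset (DeletableErrors.Word n),
      C.Nonempty ∧
      DeletableErrors.redundancy C ≤ (n : ℝ) * (4 * Real.logb 2 (2 * (d : ℝ)) / (d : ℝ)) ∧
      DeletableErrors.realTimeErrorProbability C t d ≤
        11 * ((t : ℝ) ^ 2 * (d : ℝ) / (n : ℝ)) ∧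
      DeletableErrors.reducedRealTimeErrorProbability C t d ≤
        11 * ((t : ℝ) ^ 2 * (d : ℝ) / (n : ℝ)) := by
  classical
  open DeletableErrors in
  have ht : (1 : ℝ) ≤ t := by exact_mod_cast ht1
  have hdn : d ≤ n := by
    have h : 2 * (n : ℝ) / (3 * (t : ℝ) ^ 2) ≤ n := by
      rw [div_le_iff₀ (by positivity)]
      nlinarith [one_le_pow₀ (n := 2) ht, Nat.cast_nonneg (α := ℝ) n]
    exact_mod_cast hd2.trans h
  obtain ⟨C, hC, hmark, hvt⟩ := exists_markedCode n (b := d) (by omega)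
  -- Only closure under permutations and the weight bound matter, so one estimate covers both ways
  -- of counting patterns.
  have bound : ∀ A : Finset (ErrorPattern n), (∀ σ, ∀ g ∈ A, permute σ g ∈ A) →
      (∀ g ∈ A, (Finset.univ.filter fun i => g.1 i = true).card ≤ t) →
      errorProbability A C d ≤ 11 * ((t : ℝ) ^ 2 * (d : ℝ) / (n : ℝ)) := by
    intro A hperm hw
    refine errorProbability_le (S := A.filter (Spread d)) (Finset.filter_subset _ _)
      (correctsInRealTime_of_spread (by omega) hmark hvt fun g hg => (Finset.mem_filter.1 hg).2)
      (by positivity) ?_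
    rw [← Finset.filter_not]
    refine (card_not_spread_le ht1 (by omega) (by omega) hperm hw).trans ?_
    gcongr
    norm_num
  refine ⟨C, ?_, redundancy_le (by omega) hC, ?_, ?_⟩
  · rw [← Finset.card_pos, ← Nat.cast_pos (α := ℝ)]
    have : (0 : ℝ) < d := by exact_mod_cast (show 0 < d by omega)
    exact lt_of_lt_of_le (by positivity) hC
  · exact bound _ (fun σ g hg => permute_mem_errorPatterns σ hg)
      fun g hg => (Finset.mem_filter.1 hg).2
  · exact bound _ (fun σ g hg => permute_mem_reducedErrorPatterns σ hg)
      fun g hg => (Finset.mem_filter.1 (Finset.mem_filter.1 hg).1).2
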